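/- Let $n \ge 5$, let $L = A_n$ be the alternating group on $n$ letters, let $r \le n$ be an odd prime, and let $x \in \mathrm{Aut}(L)$ be an automorphism of prime order. Identify $S_n$ with its image in $\mathrm{Aut}(L)$ under conjugation. Let $\beta_r(x,L)$ denote the minimal number of $L$-conjugates of $x$ (that is, conjugates of $x$ in $\mathrm{Aut}(L)$ by inner automorphisms of $L$) which generate a subgroup of order divisible by $r$. Then: (1) if $x$ is a transposition, then $\beta_r(x,L) = r-1$; (2) if $r = 3$, $n = 6$ and $x$ is an involution not lying in $S_6$, then $\beta_3(x,L) = 3$; (3) in all other cases, $\beta_r(x,L) \le r-1$. -/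

import Mathlib

/-- The tuple `y 0, …, y (m - 1)` consists of conjugates of the automorphism `x` of `L` by
inner automorphisms of `L`, and these conjugates generate a subgroup of `Aut L` whose order is
divisible by `r`. -/
def GeneratesOrderDivisible (r : ℕ) {L : Type*} [Group L] (x : MulAut L) {m : ℕ}
    (y : Fin m → MulAut L) : Prop :=
  (∀ i, ∃ g : L, y i = MulAut.conj g * x * (MulAut.conj g)⁻¹) ∧
    r ∣ Nat.card (Subgroup.closure (Set.range y))

/-- For an automorphism `x` of a finite group `L`, the minimal number of `L`-conjugates of `x`
which generate a subgroup of order divisible by `r`. It takes values in `ℕ∞`, and equals `⊤` if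
no number of `L`-conjugates of `x` generates such a subgroup. -/
noncomputable def betaNumber (r : ℕ) {L : Type*} [Group L] (x : MulAut L) : ℕ∞ :=
  ⨅ (m : ℕ) (_ : ∃ y : Fin m → MulAut L, GeneratesOrderDivisible r x y), (m : ℕ∞)

/-- The homomorphism from the symmetric group on `n` letters to the automorphism group of the
alternating group on `n` letters, given by conjugation. -/
def symmetricToAut (n : ℕ) : Equiv.Perm (Fin n) →* MulAut (alternatingGroup (Fin n)) :=
  MulAut.conjNormal

/-- The automorphism `x` of the alternating group is (conjugation by) a transposition. -/
def IsTranspositionAut {n : ℕ} (x : MulAut (alternatingGroup (Fin n))) : Prop :=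
  ∃ σ : Equiv.Perm (Fin n), σ.IsSwap ∧ symmetricToAut n σ = x

/-- The automorphism `x` of the alternating group is an involution which is not induced by
conjugation by an element of the symmetric group. -/
def IsInvolutionOutsideSymmetric {n : ℕ} (x : MulAut (alternatingGroup (Fin n))) : Prop :=
  orderOf x = 2 ∧ x ∉ (symmetricToAut n).range

/-!
Commutators of a nontrivial permutation `σ` with even permutations lie in the subgroup generated
by two conjugates of `σ`. If `σ` is not a fixed-point-free involution, two conjugates of a power
of `σ` thus generate a 3-cycle, and gluing 3-cycles at common letters gives an `r`-cycle at the
cost of one conjugate per letter; a fixed-point-free involution needs 5- and 7-cycles instead.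
Conversely, `m` transpositions are the edges of a graph with at least `n - m` components, so every
cycle in the group they generate moves at most `m + 1` letters.

For `n ≠ 6`, every automorphism of the alternating group preserves 3-cycles: a commutator with a
3-cycle moves at most six letters, hence never has order 7, while every other element of order 3
has commutators of order 7. An automorphism preserving 3-cycles is induced by a permutation,
because two 3-cycles whose product is an involution share exactly one arc.

For `n = 6`, an automorphism `x` outside the symmetric group exchanges the two classes of elements
of order 3, so it inverts no such element. If `x` is an involution, two conjugates of `x` generate
a dihedral group, all of whose elements of odd order are inverted by a conjugate of `x`, and hence
two conjugates do not suffice for `r = 3`.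
-/

open Equiv Equiv.Perm
open scoped commutatorElement

section ConjClosure

variable {G H : Type*} [Group G] [Group H]

/-- `t` lies in the subgroup generated by some `m` conjugates of `x` by elements of `N`. For the
inner automorphisms `N` of a finite group, an element `t` of order `r` witnesses
`betaNumber r x ≤ m`. -/
def MemConjClosure (N : Subgroup G) (x : G) (m : ℕ) (t : G) : Prop :=
  ∃ y : Fin m → G, (∀ i, ∃ g ∈ N, y i = g * x * g⁻¹) ∧ t ∈ Subgroup.closure (Set.range y)

theorem closure_range_conj_pow_le {ι : Type*} (g : ι → G) (x : G) (k : ℕ) :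
    Subgroup.closure (Set.range fun i => g i * x ^ k * (g i)⁻¹) ≤
      Subgroup.closure (Set.range fun i => g i * x * (g i)⁻¹) := by
  rw [Subgroup.closure_le]
  rintro _ ⟨i, rfl⟩
  simp only [SetLike.mem_coe, ← conj_pow]
  exact pow_mem (Subgroup.subset_closure (Set.mem_range_self i)) k

namespace MemConjClosure

variable {N : Subgroup G} {x s t : G} {l m : ℕ}

theorem one (N : Subgroup G) (x : G) (m : ℕ) : MemConjClosure N x m 1 :=
  ⟨fun _ => x, fun _ => ⟨1, N.one_mem, by simp⟩, one_mem _⟩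

theorem self (N : Subgroup G) (x : G) : MemConjClosure N x 1 x :=
  ⟨fun _ => x, fun _ => ⟨1, N.one_mem, by simp⟩, Subgroup.subset_closure ⟨0, rfl⟩⟩

theorem inv (h : MemConjClosure N x m t) : MemConjClosure N x m t⁻¹ := by
  obtain ⟨y, hy, ht⟩ := h
  exact ⟨y, hy, inv_mem ht⟩

theorem mul (hs : MemConjClosure N x l s) (ht : MemConjClosure N x m t) :
    MemConjClosure N x (l + m) (s * t) := by
  obtain ⟨y, hy, hs⟩ := hs
  obtain ⟨z, hz, ht⟩ := ht
  refine ⟨Fin.append y z, fun i => ?_, mul_mem ?_ ?_⟩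
  · induction i using Fin.addCases with
    | left i => simpa using hy i
    | right i => simpa using hz i
  · refine Subgroup.closure_mono ?_ hs
    rintro _ ⟨i, rfl⟩
    exact ⟨Fin.castAdd m i, by simp⟩
  · refine Subgroup.closure_mono ?_ ht
    rintro _ ⟨i, rfl⟩
    exact ⟨Fin.natAdd l i, by simp⟩

theorem mono (h : MemConjClosure N x l t) (hlm : l ≤ m) : MemConjClosure N x m t := by
  simpa [Nat.add_sub_cancel' hlm] using h.mul (one N x (m - l))

theorem conj (h : MemConjClosure N x m t) {g : G} (hg : g ∈ N) :
    MemConjClosure N x m (g * t * g⁻¹) := by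
  obtain ⟨y, hy, ht⟩ := h
  refine ⟨fun i => g * y i * g⁻¹, fun i => ?_, ?_⟩
  · obtain ⟨k, hk, e⟩ := hy i
    exact ⟨g * k, mul_mem hg hk, by simp only [e]; group⟩
  · have := Subgroup.mem_map_of_mem (MulAut.conj g).toMonoidHom ht
    rwa [MonoidHom.map_closure, ← Set.range_comp] at this

theorem commutator (h : MemConjClosure N x m t) {g : G} (hg : g ∈ N) :
    MemConjClosure N x (2 * m) ⁅t, g⁆ := by
  have hcomm : ⁅t, g⁆ = t * (g * t⁻¹ * g⁻¹) := by rw [commutatorElement_def]; group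
  rw [hcomm, two_mul]
  exact h.mul (h.inv.conj hg)

theorem map (f : G →* H) (h : MemConjClosure N x m t) :
    MemConjClosure (N.map f) (f x) m (f t) := by
  obtain ⟨y, hy, ht⟩ := h
  refine ⟨fun i => f (y i), fun i => ?_, ?_⟩
  · obtain ⟨g, hg, e⟩ := hy i
    exact ⟨f g, Subgroup.mem_map_of_mem f hg, by simp [e]⟩
  · have := Subgroup.mem_map_of_mem f ht
    rwa [MonoidHom.map_closure, ← Set.range_comp] at this

theorem of_pow {k : ℕ} (h : MemConjClosure N (x ^ k) m t) : MemConjClosure N x m t := by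
  obtain ⟨y, hy, ht⟩ := h
  choose g hg hyg using hy
  obtain rfl := funext hyg
  exact ⟨_, fun i => ⟨g i, hg i, rfl⟩, closure_range_conj_pow_le g x k ht⟩

end MemConjClosure

theorem betaNumber_le_of_memConjClosure {L : Type*} [Group L] {m : ℕ} {x t : MulAut L}
    (h : MemConjClosure (MulAut.conj (G := L)).range x m t) : betaNumber (orderOf t) x ≤ m := by
  obtain ⟨y, hy, ht⟩ := h
  refine iInf₂_le m ⟨y, fun i => ?_, ?_⟩
  · obtain ⟨_, ⟨g, rfl⟩, e⟩ := hy i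
    exact ⟨g, e⟩
  · rw [← Subgroup.orderOf_mk t ht]
    exact orderOf_dvd_natCard _

theorem betaNumber_le_betaNumber_pow {L : Type*} [Group L] (r : ℕ) (x : MulAut L) (k : ℕ) :
    betaNumber r x ≤ betaNumber r (x ^ k) := by
  refine le_iInf₂ fun m ⟨y, hy, hdvd⟩ => ?_
  choose g hg using hy
  obtain rfl := funext hg
  exact iInf₂_le m ⟨_, fun i => ⟨g i, rfl⟩, hdvd.trans (Subgroup.card_dvd_of_le
    (closure_range_conj_pow_le (fun i => MulAut.conj (g i)) x k))⟩

end ConjClosure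

section Transport

variable {α β : Type*}

theorem sign_viaEmbedding [Fintype α] [DecidableEq α] [Fintype β] [DecidableEq β] (e : α ↪ β)
    (g : Perm α) : sign (g.viaEmbedding e) = sign g := by
  rw [viaEmbedding]
  convert sign_extendDomain g (ofInjective e.1 e.2)

theorem commutatorElement_viaEmbeddingHom (e : α ↪ β) {σ : Perm β} {s g : Perm α}
    (h : ∀ i, g i ≠ i → σ (e i) = e (s i)) :
    ⁅σ, viaEmbeddingHom e g⁆ = viaEmbeddingHom e ⁅s, g⁆ := by
  suffices hconj : σ * viaEmbeddingHom e g * σ⁻¹ = viaEmbeddingHom e (s * g * s⁻¹) by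
    rw [commutatorElement_def, commutatorElement_def, hconj, map_mul _ (s * g * s⁻¹), map_inv]
  rw [mul_inv_eq_iff_eq_mul]
  ext1 x
  simp only [Perm.mul_apply, viaEmbeddingHom_apply]
  by_cases hx : ∃ i, e i = x ∧ g i ≠ i
  · obtain ⟨i, rfl, hi⟩ := hx
    simp only [viaEmbedding_apply, h i hi, h (g i) (g.injective.ne hi), Perm.mul_apply,
      Perm.coe_inv, symm_apply_apply]
  · have hgx : g.viaEmbedding e x = x := by
      by_cases hxe : x ∈ Set.range e
      · obtain ⟨i, rfl⟩ := hxe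
        rw [viaEmbedding_apply, not_not.1 fun hi => hx ⟨i, rfl, hi⟩]
      · exact viaEmbedding_apply_of_notMem _ _ _ hxe
    rw [hgx]
    by_cases hσx : σ x ∈ Set.range e
    · obtain ⟨k, hk⟩ := hσx
      have hgk : g (s.symm k) = s.symm k := by
        by_contra hgk
        refine hx ⟨s.symm k, σ.injective ?_, hgk⟩
        rw [h _ hgk, ← hk, apply_symm_apply]
      rw [← hk, viaEmbedding_apply, Perm.mul_apply, Perm.mul_apply, Perm.coe_inv, hgk,
        apply_symm_apply]
    · rw [viaEmbedding_apply_of_notMem _ _ _ hσx]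

theorem viaEmbeddingHom_swap [DecidableEq α] [DecidableEq β] (e : α ↪ β) (a b : α) :
    viaEmbeddingHom e (swap a b) = swap (e a) (e b) := by
  ext z
  rw [viaEmbeddingHom_apply]
  by_cases hz : z ∈ Set.range e
  · obtain ⟨c, rfl⟩ := hz
    rw [viaEmbedding_apply, e.injective.map_swap]
  · rw [viaEmbedding_apply_of_notMem _ _ _ hz, swap_apply_of_ne_of_ne]
    · rintro rfl; exact hz ⟨a, rfl⟩
    · rintro rfl; exact hz ⟨b, rfl⟩

theorem viaEmbeddingHom_formPerm [DecidableEq α] [DecidableEq β] (e : α ↪ β) (l : List α) :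
    viaEmbeddingHom e l.formPerm = (l.map e).formPerm := by
  induction l using List.twoStepInduction with
  | nil | singleton => simp
  | cons_cons a b l _ ih =>
    rw [List.formPerm_cons_cons, map_mul, ih b, viaEmbeddingHom_swap]
    simp

theorem MemConjClosure.commutator_viaEmbeddingHom [Fintype α] [DecidableEq α] [Fintype β]
    [DecidableEq β] {x σ : Perm β} {m : ℕ} (hσ : MemConjClosure (alternatingGroup β) x m σ)
    (e : α ↪ β) (s g : Perm α) (hg : sign g = 1)
    (h : ∀ i, g i ≠ i → σ (e i) = e (s i)) :
    MemConjClosure (alternatingGroup β) x (2 * m) (viaEmbeddingHom e ⁅s, g⁆) := by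
  rw [← commutatorElement_viaEmbeddingHom e h]
  exact hσ.commutator <| mem_alternatingGroup.2 <| (sign_viaEmbedding e g).trans hg

end Transport

theorem formPerm_concat_mul_formPerm_cons {α : Type*} [DecidableEq α] (l l' : List α)
    (a : α) :
    (l ++ [a]).formPerm * (a :: l').formPerm = (l ++ a :: l').formPerm := by
  induction l using List.twoStepInduction with
  | nil => simp
  | singleton b => simp [List.formPerm_cons_cons]
  | cons_cons b c l _ ih =>
    simp only [List.cons_append, List.formPerm_cons_cons] at ih ⊢
    rw [← ih c, mul_assoc]

section Cycles

variable {α : Type*} [Fintype α] [DecidableEq α]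

theorem cycleType_formPerm {l : List α} (hl : l.Nodup) (h2 : 2 ≤ l.length) :
    l.formPerm.cycleType = {l.length} := by
  rw [(List.isCycle_formPerm hl h2).cycleType,
    List.support_formPerm_of_nodup l hl (by rintro x rfl; simp at h2),
    List.toFinset_card_of_nodup hl]

theorem orderOf_formPerm {α : Type*} [Finite α] [DecidableEq α] {l : List α} (hl : l.Nodup)
    (h0 : l ≠ []) : orderOf l.formPerm = l.length := by
  have := Fintype.ofFinite α
  rcases Nat.lt_or_ge l.length 2 with h | h
  · rw [(List.formPerm_eq_one_iff l hl).2 (by omega), orderOf_one]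
    have := List.length_pos_iff.2 h0
    omega
  · rw [← lcm_cycleType, cycleType_formPerm hl h, Multiset.lcm_singleton, normalize_eq]

theorem formPerm_mem_alternatingGroup {l : List α} (hl : l.Nodup) (hodd : Odd l.length) :
    l.formPerm ∈ alternatingGroup α := by
  rcases Nat.lt_or_ge l.length 2 with h | h
  · rw [(List.formPerm_eq_one_iff l hl).2 (by omega)]
    exact one_mem _
  · rw [mem_alternatingGroup, sign_of_cycleType, cycleType_formPerm hl h]
    simp [hodd.add_one.neg_one_pow]

theorem isThreeCycle_formPerm {a b c : α} (h : [a, b, c].Nodup) :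
    [a, b, c].formPerm.IsThreeCycle :=
  cycleType_formPerm h (by simp)

theorem exists_alternatingGroup_conj_formPerm {l l' : List α} (hl : l.Nodup) (hl' : l'.Nodup)
    (hlen : l'.length = l.length) (h2 : 2 ≤ l.length) (hodd : Odd l.length)
    (hcard : l.length + 2 ≤ Fintype.card α) :
    ∃ g ∈ alternatingGroup α, g * l.formPerm * g⁻¹ = l'.formPerm := by
  have hc : IsConj l.formPerm l'.formPerm := by
    rw [isConj_iff_cycleType_eq, cycleType_formPerm hl h2, cycleType_formPerm hl' (hlen ▸ h2),
      hlen]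
  have h := alternatingGroup.isConj_of (σ := ⟨_, formPerm_mem_alternatingGroup hl hodd⟩)
    (τ := ⟨_, formPerm_mem_alternatingGroup hl' (hlen ▸ hodd)⟩) hc (by
      rwa [← sum_cycleType, cycleType_formPerm hl h2, Multiset.sum_singleton])
  obtain ⟨g, hg⟩ := isConj_iff.1 h
  exact ⟨g, g.2, congrArg Subtype.val hg⟩

theorem exists_nodup_append {α : Type*} [Fintype α] {t : ℕ} (l : List α) (hl : l.Nodup)
    (h : l.length + t ≤ Fintype.card α) : ∃ d : List α, d.length = t ∧ (l ++ d).Nodup := by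
  classical
  have hcompl : t ≤ (l.toFinset)ᶜ.card := by
    rw [Finset.card_compl, List.toFinset_card_of_nodup hl]
    omega
  obtain ⟨s, hs, hst⟩ := Finset.exists_subset_card_eq hcompl
  refine ⟨s.toList, by simpa using hst, hl.append s.nodup_toList fun a hal ha => ?_⟩
  simpa [hal] using hs (Finset.mem_toList.1 ha)

/-- Some cycle of length `r` lies in the subgroup generated by `m` conjugates of `x` by even
permutations. The cycle is recorded as a list, so that a cycle of length one makes sense. -/
def HasCycleInConjClosure (x : Perm α) (r m : ℕ) : Prop :=
  ∃ l : List α, l.Nodup ∧ l.length = r ∧ MemConjClosure (alternatingGroup α) x m l.formPerm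

namespace HasCycleInConjClosure

variable {x : Perm α} {k m r t : ℕ}

theorem mono (h : HasCycleInConjClosure x r k) (hkm : k ≤ m) : HasCycleInConjClosure x r m := by
  obtain ⟨l, hl, hlen, h⟩ := h
  exact ⟨l, hl, hlen, h.mono hkm⟩

theorem memConjClosure (h : HasCycleInConjClosure x r m) (h2 : 2 ≤ r) (hodd : Odd r)
    (hcard : r + 2 ≤ Fintype.card α) {l : List α} (hl : l.Nodup) (hlen : l.length = r) :
    MemConjClosure (alternatingGroup α) x m l.formPerm := by
  obtain ⟨l', hl', rfl, h⟩ := h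
  obtain ⟨g, hg, e⟩ := exists_alternatingGroup_conj_formPerm hl' hl hlen h2 hodd hcard
  exact e ▸ h.conj hg

theorem exists_orderOf_eq (h : HasCycleInConjClosure x r m) (hr : r ≠ 0) :
    ∃ t, orderOf t = r ∧ MemConjClosure (alternatingGroup α) x m t := by
  obtain ⟨l, hl, rfl, h⟩ := h
  exact ⟨_, orderOf_formPerm hl (by simpa using hr), h⟩

theorem of_eq_formPerm {k : ℕ} {e : Fin k ↪ α} {t : Perm (Fin k)}
    (h : MemConjClosure (alternatingGroup α) x m (viaEmbeddingHom e t)) (l : List (Fin k))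
    (hl : l.Nodup) (ht : t = l.formPerm) : HasCycleInConjClosure x l.length m :=
  ⟨l.map e, hl.map e.injective, List.length_map _, by rwa [← viaEmbeddingHom_formPerm, ← ht]⟩

-- An `r`-cycle and a `(t + 1)`-cycle with one letter in common multiply to an `(r + t)`-cycle.
theorem extend (h : HasCycleInConjClosure x r m) (hr : r ≠ 0)
    (h' : HasCycleInConjClosure x (t + 1) k) (ht : t ≠ 0) (hodd : Odd (t + 1))
    (hcard : t + 3 ≤ Fintype.card α) (hrt : r + t ≤ Fintype.card α) :
    HasCycleInConjClosure x (r + t) (m + k) := by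
  obtain ⟨l, hl, rfl, h⟩ := h
  obtain ⟨d, rfl, hld⟩ := exists_nodup_append l hl hrt
  obtain rfl | ⟨l, a, rfl⟩ := l.eq_nil_or_concat
  · simp at hr
  rw [List.concat_eq_append] at h hld ⊢
  have had : (a :: d).Nodup := by
    rw [List.append_assoc, List.singleton_append] at hld
    exact hld.of_append_right
  refine ⟨l ++ a :: d, by simpa using hld, by simp; omega, ?_⟩
  rw [← formPerm_concat_mul_formPerm_cons]
  exact h.mul (h'.memConjClosure (by omega) hodd (by omega) had (by simp))

theorem of_three (h : HasCycleInConjClosure x 3 2) (hcard : 5 ≤ Fintype.card α)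
    (hodd : Odd r) (hr : r ≤ Fintype.card α) : HasCycleInConjClosure x r (r - 1) := by
  obtain ⟨j, rfl⟩ := hodd
  induction j with
  | zero =>
    obtain ⟨a⟩ : Nonempty α := Fintype.card_pos_iff.1 (by omega)
    exact ⟨[a], by simp, rfl, by simpa using MemConjClosure.one _ x 0⟩
  | succ j ih =>
    refine ((ih (by omega)).extend (t := 2) (by omega) h (by omega) (by decide) hcard
      (by omega)).mono (by omega)

theorem of_five_seven (h5 : HasCycleInConjClosure x 5 4)
    (h7 : 7 ≤ Fintype.card α → HasCycleInConjClosure x 7 6) (h : 5 ≤ r) (hodd : Odd r)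
    (hr : r ≤ Fintype.card α) : HasCycleInConjClosure x r (r - 1) := by
  induction r using Nat.strong_induction_on with
  | _ r ih =>
    rcases Nat.lt_or_ge r 9 with h9 | h9
    · obtain ⟨j, rfl⟩ := hodd
      obtain rfl | rfl : j = 2 ∨ j = 3 := by omega
      · exact h5
      · exact h7 hr
    · obtain ⟨q, rfl⟩ := Nat.exists_eq_add_of_le' (show 4 ≤ r by omega)
      have hq : Odd q := by
        rcases hodd with ⟨j, hj⟩
        exact ⟨j - 2, by omega⟩
      exact ((ih q (by omega) (by omega) hq (by omega)).extend (t := 4) (by omega) h5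
        (by omega) (by decide) (by omega) hr).mono (by omega)

end HasCycleInConjClosure

/-- The embedding of `Fin k` which lists the entries of a list of length `k` without repetitions.
It transports computations in a small symmetric group to the letters of the list. -/
def listEmbedding {β : Type*} {l : List β} (h : l.Nodup) {k : ℕ} (hk : l.length = k) :
    Fin k ↪ β :=
  ⟨fun i => l.get (i.cast hk.symm), (List.nodup_iff_injective_get.1 h).comp (Fin.cast_injective _)⟩

section NontrivialPerm

variable {σ : Perm α}

theorem exists_apply_ne_of_ne_one {α : Type*} {σ : Perm α} (hne : σ ≠ 1) : ∃ a, σ a ≠ a :=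
  not_forall.1 fun h => hne (Perm.ext h)

theorem eq_formPerm_of_isThreeCycle (hσ : σ.IsThreeCycle) {a : α} (ha : σ a ≠ a) :
    σ = [a, σ a, σ (σ a)].formPerm := by
  conv_lhs => rw [← hσ.isCycle.cycleOf_eq ha, ← formPerm_toList, toList, hσ.isCycle.cycleOf_eq ha,
    hσ.card_support]
  rfl

theorem nodup_of_isThreeCycle (hσ : σ.IsThreeCycle) {a : α} (ha : σ a ≠ a) :
    [a, σ a, σ (σ a)].Nodup := by
  have h := nodup_toList σ a
  rw [toList, hσ.isCycle.cycleOf_eq ha, hσ.card_support] at h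
  exact h

theorem hasCycle_three_of_nodup_orbit {a : α}
    (ha : [a, σ a, σ (σ a), σ (σ (σ a))].Nodup) : HasCycleInConjClosure σ 3 2 :=
  .of_eq_formPerm ((MemConjClosure.self _ σ).commutator_viaEmbeddingHom
      (listEmbedding ha (k := 4) rfl) (c[0, 1, 2, 3]) (c[0, 1, 2]) (by decide)
      (by intro i hi; fin_cases i <;> first | rfl | exact absurd rfl hi))
    [0, 3, 1] (by decide) (by decide)

theorem hasCycle_three_of_two_three_cycles {a b : α} (hσ : ∀ z, σ (σ (σ z)) = z)
    (hab : [a, σ a, σ (σ a), b, σ b, σ (σ b)].Nodup) : HasCycleInConjClosure σ 3 2 :=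
  .of_eq_formPerm ((MemConjClosure.self _ σ).commutator_viaEmbeddingHom
      (listEmbedding hab (k := 6) rfl) (c[0, 1, 2] * c[3, 4, 5]) (c[0, 3] * c[1, 4, 2, 5])
      (by decide) (by intro i hi; fin_cases i <;> first | rfl | exact hσ _))
    [0, 2, 1] (by decide) (by decide)

theorem isThreeCycle_or_exists_nodup (hσ : ∀ z, σ (σ (σ z)) = z) (hne : σ ≠ 1) :
    σ.IsThreeCycle ∨ ∃ a b, [a, σ a, σ (σ a), b, σ b, σ (σ b)].Nodup := by
  obtain ⟨a, ha⟩ := exists_apply_ne_of_ne_one hne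
  have hnd : [a, σ a, σ (σ a)].Nodup := by grind
  by_cases h : ∃ b, σ b ≠ b ∧ b ∉ [a, σ a, σ (σ a)]
  · obtain ⟨b, hb, hab⟩ := h
    exact .inr ⟨a, b, by grind [σ.injective.eq_iff]⟩
  · left
    have hsupp : σ.support = [a, σ a, σ (σ a)].toFinset := by
      ext z
      rw [mem_support, List.mem_toFinset]
      exact ⟨fun hz => not_not.1 fun hz' => h ⟨z, hz, hz'⟩, by grind⟩
    rw [← card_support_eq_three_iff, hsupp, List.toFinset_card_of_nodup hnd]
    rfl

theorem hasCycle_three_of_pow_three (hσ : ∀ z, σ (σ (σ z)) = z) (hne : σ ≠ 1) :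
    HasCycleInConjClosure σ 3 2 := by
  rcases isThreeCycle_or_exists_nodup hσ hne with h3 | ⟨a, b, hab⟩
  · obtain ⟨a, ha⟩ := exists_apply_ne_of_ne_one hne
    refine ⟨[a, σ a, σ (σ a)], nodup_of_isThreeCycle h3 ha, rfl, ?_⟩
    rw [← eq_formPerm_of_isThreeCycle h3 ha]
    exact (MemConjClosure.self _ σ).mono one_le_two
  · exact hasCycle_three_of_two_three_cycles hσ hab

theorem hasCycle_three_of_involution {a f : α} (hσ : ∀ z, σ (σ z) = z) (ha : σ a ≠ a)
    (hf : σ f = f) : HasCycleInConjClosure σ 3 2 := by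
  have hnd : [a, σ a, f].Nodup := by grind
  exact .of_eq_formPerm ((MemConjClosure.self _ σ).commutator_viaEmbeddingHom
      (listEmbedding hnd (k := 3) rfl) (c[0, 1]) (c[0, 1, 2]) (by decide)
      (by intro i hi; fin_cases i; exacts [rfl, hσ _, hf]))
    [0, 1, 2] (by decide) (by decide)

theorem hasCycle_three_or_involution (hne : σ ≠ 1) :
    HasCycleInConjClosure σ 3 2 ∨ ∀ z, σ (σ z) = z ∧ σ z ≠ z := by
  by_cases h4 : ∃ a, [a, σ a, σ (σ a), σ (σ (σ a))].Nodup
  · exact .inl (hasCycle_three_of_nodup_orbit h4.choose_spec)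
  have h6 : ∀ z, σ (σ z) = z ∨ σ (σ (σ z)) = z := by
    intro z
    by_contra h
    exact h4 ⟨z, by grind [σ.injective.eq_iff]⟩
  by_cases h2 : σ ^ 2 = 1
  · have hinv : ∀ z, σ (σ z) = z := fun z => congr($h2 z)
    obtain ⟨a, ha⟩ := exists_apply_ne_of_ne_one hne
    by_cases hf : ∃ f, σ f = f
    · exact .inl (hasCycle_three_of_involution hinv ha hf.choose_spec)
    · exact .inr fun z => ⟨hinv z, not_exists.1 hf z⟩
  · obtain ⟨l, hl, hlen, h⟩ := hasCycle_three_of_pow_three (σ := σ ^ 2) (fun z => by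
      simp only [pow_two, Perm.mul_apply]
      grind) h2
    exact .inl ⟨l, hl, hlen, h.of_pow⟩

theorem exists_notMem_of_length_lt {α : Type*} [Fintype α] (l : List α)
    (h : l.length < Fintype.card α) : ∃ a, a ∉ l := by
  classical
  by_contra! hall
  have huniv : Finset.univ ⊆ l.toFinset := fun a _ => List.mem_toFinset.2 (hall a)
  exact h.not_ge ((Finset.card_le_card huniv).trans (List.toFinset_card_le l))

theorem exists_three_pairs {α : Type*} [Fintype α] {σ : Perm α}
    (hσ : ∀ z, σ (σ z) = z ∧ σ z ≠ z) (hcard : 5 ≤ Fintype.card α) :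
    ∃ a b c, [a, σ a, b, σ b, c, σ c].Nodup := by
  obtain ⟨a, -⟩ := exists_notMem_of_length_lt ([] : List α) (by simp; omega)
  obtain ⟨b, hb⟩ := exists_notMem_of_length_lt [a, σ a] (by simp; omega)
  obtain ⟨c, hc⟩ := exists_notMem_of_length_lt [a, σ a, b, σ b] (by simp; omega)
  exact ⟨a, b, c, by grind⟩

theorem exists_orderOf_eq_three_of_three_pairs {a b c : α}
    (h : [a, σ a, b, σ b, c, σ c].Nodup) :
    ∃ t, orderOf t = 3 ∧ MemConjClosure (alternatingGroup α) σ 2 t := by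
  refine ⟨_, ?_, (MemConjClosure.self _ σ).commutator_viaEmbeddingHom
      (listEmbedding h (k := 6) rfl) (c[0, 1] * c[2, 3] * c[4, 5]) (c[0, 2, 4]) (by decide)
      (by intro i hi; fin_cases i <;> first | rfl | exact absurd rfl hi)⟩
  rw [orderOf_injective _ (viaEmbeddingHom_injective _)]
  exact orderOf_eq_prime (by decide +kernel) (by decide +kernel)

theorem hasCycle_five_of_three_pairs {a b c : α} (h : [a, σ a, b, σ b, c, σ c].Nodup) :
    HasCycleInConjClosure σ 5 4 := by
  have h3 := (MemConjClosure.self _ σ).commutator_viaEmbeddingHom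
      (listEmbedding h (k := 6) rfl) (c[0, 1] * c[2, 3] * c[4, 5]) (c[0, 2, 4]) (by decide)
      (by intro i hi; fin_cases i <;> first | rfl | exact absurd rfl hi)
  exact .of_eq_formPerm (h3.commutator_viaEmbeddingHom _ _ (c[0, 1, 2]) (by decide)
    fun i _ => viaEmbedding_apply _ _ i) [0, 2, 1, 4, 3] (by decide) (by decide +kernel)

theorem hasCycle_seven_of_three_pairs {a b c d : α} (h : [a, σ a, b, σ b, c, σ c, d].Nodup) :
    HasCycleInConjClosure σ 7 4 := by
  have h3 := (MemConjClosure.self _ σ).commutator_viaEmbeddingHom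
      (listEmbedding h (k := 7) rfl) (c[0, 1] * c[2, 3] * c[4, 5]) (c[0, 2, 4]) (by decide)
      (by intro i hi; fin_cases i <;> first | rfl | exact absurd rfl hi)
  exact .of_eq_formPerm (h3.commutator_viaEmbeddingHom _ _ (c[0, 1, 2, 3, 6]) (by decide)
    fun i _ => viaEmbedding_apply _ _ i) [0, 4, 3, 2, 1, 5, 6] (by decide)
    (by decide +kernel)

theorem exists_orderOf_eq_of_involution (hσ : ∀ z, σ (σ z) = z ∧ σ z ≠ z)
    (hcard : 5 ≤ Fintype.card α) {r : ℕ} (hodd : Odd r) (hr : r ≤ Fintype.card α) :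
    ∃ t, orderOf t = r ∧ MemConjClosure (alternatingGroup α) σ (r - 1) t := by
  obtain ⟨a, b, c, habc⟩ := exists_three_pairs hσ hcard
  obtain rfl | rfl | h5 : r = 1 ∨ r = 3 ∨ 5 ≤ r := by
    obtain ⟨j, rfl⟩ := hodd
    omega
  · exact ⟨1, orderOf_one, .one _ _ _⟩
  · exact exists_orderOf_eq_three_of_three_pairs habc
  · refine (HasCycleInConjClosure.of_five_seven (hasCycle_five_of_three_pairs habc)
      (fun h7 => ?_) h5 hodd hr).exists_orderOf_eq (by omega)
    obtain ⟨d, hd⟩ := exists_notMem_of_length_lt [a, σ a, b, σ b, c, σ c] h7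
    exact (hasCycle_seven_of_three_pairs (a := a) (b := b) (c := c) (d := d)
      (by grind)).mono (by omega)

theorem exists_orderOf_eq_of_ne_one (hne : σ ≠ 1) (hcard : 5 ≤ Fintype.card α) {r : ℕ}
    (hodd : Odd r) (hr : r ≤ Fintype.card α) :
    ∃ t, orderOf t = r ∧ MemConjClosure (alternatingGroup α) σ (r - 1) t := by
  rcases hasCycle_three_or_involution hne with h3 | hinv
  · exact (h3.of_three hcard hodd hr).exists_orderOf_eq hodd.pos.ne'
  · exact exists_orderOf_eq_of_involution hinv hcard hodd hr

end NontrivialPerm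

end Cycles

section SymmetricToAut

variable {n : ℕ}

theorem symmetricToAut_coe (g : alternatingGroup (Fin n)) :
    symmetricToAut n g = MulAut.conj g :=
  MulAut.conjNormal_val

theorem coe_symmetricToAut_apply (σ : Perm (Fin n)) (g : alternatingGroup (Fin n)) :
    (symmetricToAut n σ g : Perm (Fin n)) = σ * g * σ⁻¹ :=
  MulAut.conjNormal_apply σ g

theorem map_symmetricToAut_alternatingGroup (n : ℕ) :
    (alternatingGroup (Fin n)).map (symmetricToAut n) = (MulAut.conj).range := by
  ext f
  constructor
  · rintro ⟨g, hg, rfl⟩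
    exact ⟨⟨g, hg⟩, (symmetricToAut_coe ⟨g, hg⟩).symm⟩
  · rintro ⟨g, rfl⟩
    exact ⟨g, g.2, symmetricToAut_coe g⟩

theorem symmetricToAut_injective (hn : 4 ≤ n) : Function.Injective (symmetricToAut n) := by
  rw [injective_iff_map_eq_one]
  intro σ hσ
  ext1 a
  rw [Perm.one_apply]
  by_contra hne
  obtain ⟨b, hb⟩ := exists_notMem_of_length_lt [a, σ a, σ (σ a)] (by simp; omega)
  have hnd : [a, σ a, b].Nodup := by grind
  have hcomm := coe_symmetricToAut_apply σ ⟨_, (isThreeCycle_formPerm hnd).mem_alternatingGroup⟩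
  rw [hσ, MulAut.one_apply, eq_mul_inv_iff_mul_eq] at hcomm
  have hσa : [a, σ a, b].formPerm (σ a) = b := List.formPerm_apply_lt_getElem _ hnd 1 (by simp)
  have ha : [a, σ a, b].formPerm a = σ a := List.formPerm_apply_head _ _ _ hnd
  have hba : b = σ (σ a) := by simpa only [Perm.mul_apply, hσa, ha] using congr($hcomm a)
  simp [hba] at hb

theorem betaNumber_symmetricToAut_le (hn : 4 ≤ n) {m : ℕ} {σ t : Perm (Fin n)}
    (h : MemConjClosure (alternatingGroup (Fin n)) σ m t) :
    betaNumber (orderOf t) (symmetricToAut n σ) ≤ m := by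
  have h' := h.map (symmetricToAut n)
  rw [map_symmetricToAut_alternatingGroup] at h'
  rw [← orderOf_injective _ (symmetricToAut_injective hn) t]
  exact betaNumber_le_of_memConjClosure h'

theorem betaNumber_symmetricToAut_le_sub_one (hn : 5 ≤ n) {r : ℕ} (hodd : Odd r) (hr : r ≤ n)
    {σ : Perm (Fin n)} (hσ : σ ≠ 1) : betaNumber r (symmetricToAut n σ) ≤ ((r - 1 : ℕ) : ℕ∞) := by
  obtain ⟨t, rfl, ht⟩ := exists_orderOf_eq_of_ne_one hσ (by simpa using hn) hodd (by simpa using hr)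
  exact betaNumber_symmetricToAut_le (by omega) ht

theorem exists_orderOf_eq_of_generatesOrderDivisible {L : Type*} [Group L] [Finite L] {r m : ℕ}
    (hr : r.Prime) {x : MulAut L} {y : Fin m → MulAut L} (h : GeneratesOrderDivisible r x y) :
    ∃ w ∈ Subgroup.closure (Set.range y), orderOf w = r := by
  have : Finite (MulAut L) := .of_injective (fun f : MulAut L => (f : L → L)) DFunLike.coe_injective
  have := Fact.mk hr
  obtain ⟨⟨w, hw⟩, hord⟩ := exists_prime_orderOf_dvd_card' r h.2
  exact ⟨w, hw, by rwa [Subgroup.orderOf_mk] at hord⟩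

end SymmetricToAut

section SwapLowerBound

variable {α β : Type*} [Fintype α] [DecidableEq α] [DecidableEq β]

theorem exists_invariant_of_isSwap {m : ℕ} (y : Fin m → Perm α) (hy : ∀ i, (y i).IsSwap) :
    ∃ c : α → α, (∀ i a, c (y i a) = c a) ∧
      Fintype.card α ≤ (Finset.univ.image c).card + m := by
  induction m with
  | zero => exact ⟨id, fun i => i.elim0, by simp⟩
  | succ m ih =>
    obtain ⟨c, hc, hcard⟩ := ih (fun i => y i.castSucc) (fun i => hy _)
    obtain ⟨a, b, -, hab⟩ := hy (Fin.last m)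
    refine ⟨fun z => if c z = c b then c a else c z, fun i z => ?_, ?_⟩
    · induction i using Fin.lastCases with
      | last => simp only [hab, swap_apply_def]; grind
      | cast i => simp only [hc]
    · have hsub : Finset.univ.image c ⊆
          insert (c b) (Finset.univ.image fun z => if c z = c b then c a else c z) := by
        intro w hw
        obtain ⟨z, -, rfl⟩ := Finset.mem_image.1 hw
        by_cases hz : c z = c b
        · simp [hz]
        · exact Finset.mem_insert_of_mem (Finset.mem_image.2 ⟨z, Finset.mem_univ _, by simp [hz]⟩)
      have := (Finset.card_le_card hsub).trans (Finset.card_insert_le _ _)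
      omega

theorem apply_eq_of_mem_closure {α β : Type*} {S : Set (Perm α)} {c : α → β}
    (hc : ∀ s ∈ S, ∀ a, c (s a) = c a) {t : Perm α} (ht : t ∈ Subgroup.closure S) (a : α) :
    c (t a) = c a := by
  induction ht using Subgroup.closure_induction generalizing a with
  | mem s hs => exact hc s hs a
  | one => rfl
  | mul s t _ _ hs ht => exact (hs (t a)).trans (ht a)
  | inv s _ hs => rw [← hs (s⁻¹ a), Perm.coe_inv, apply_symm_apply]

theorem card_image_add_card_le {α : Type*} [Fintype α] {c : α → β} {S : Finset α} {a : α}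
    (hS : ∀ b ∈ S, c b = c a) : (Finset.univ.image c).card + S.card ≤ Fintype.card α + 1 := by
  classical
  have hsub : Finset.univ.image c ⊆ insert (c a) (Sᶜ.image c) := by
    intro w hw
    obtain ⟨z, -, rfl⟩ := Finset.mem_image.1 hw
    by_cases hz : z ∈ S
    · exact hS z hz ▸ Finset.mem_insert_self _ _
    · exact Finset.mem_insert_of_mem (Finset.mem_image_of_mem _ (Finset.mem_compl.2 hz))
  have himage := (Finset.card_le_card hsub).trans (Finset.card_insert_le _ _)
  have hcompl : (Sᶜ.image c).card ≤ Sᶜ.card := Finset.card_image_le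
  have := S.card_le_univ
  rw [Finset.card_compl] at hcompl
  omega

theorem card_support_cycleOf_of_orderOf_prime {t : Perm α} (ht : (orderOf t).Prime) {a : α}
    (ha : t a ≠ a) : (t.cycleOf a).support.card = orderOf t := by
  have hcyc := isCycle_cycleOf t ha
  rw [← hcyc.orderOf]
  exact (ht.eq_one_or_self_of_dvd _ (orderOf_cycleOf_dvd_orderOf t a)).resolve_left
    fun h => hcyc.ne_one (orderOf_eq_one_iff.1 h)

theorem orderOf_le_of_mem_closure_isSwap {α : Type*} [Finite α] [DecidableEq α] {m : ℕ}
    {y : Fin m → Perm α} (hy : ∀ i, (y i).IsSwap) {t : Perm α}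
    (ht : t ∈ Subgroup.closure (Set.range y)) (hp : (orderOf t).Prime) : orderOf t ≤ m + 1 := by
  have := Fintype.ofFinite α
  obtain ⟨c, hc, hcard⟩ := exists_invariant_of_isSwap y hy
  have hconst : ∀ g ∈ Subgroup.zpowers t, ∀ b, c (g b) = c b := fun g hg =>
    apply_eq_of_mem_closure (by rintro _ ⟨i, rfl⟩; exact hc i)
      ((Subgroup.zpowers_le.2 ht) hg)
  obtain ⟨a, ha⟩ := exists_apply_ne_of_ne_one fun h => hp.ne_one (orderOf_eq_one_iff.2 h)
  have hle := card_image_add_card_le (c := c) (S := (t.cycleOf a).support) (a := a) fun b hb => by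
    obtain ⟨k, rfl⟩ := (mem_support_cycleOf_iff.1 hb).1
    exact hconst _ (Subgroup.zpow_mem_zpowers t k) a
  rw [card_support_cycleOf_of_orderOf_prime hp ha] at hle
  omega

theorem sub_one_le_betaNumber_of_isSwap {n r : ℕ} (hn : 4 ≤ n) (hr : r.Prime)
    {σ : Perm (Fin n)} (hσ : σ.IsSwap) :
    ((r - 1 : ℕ) : ℕ∞) ≤ betaNumber r (symmetricToAut n σ) := by
  refine le_iInf₂ fun m ⟨y, hy⟩ => ?_
  obtain ⟨w, hw, rfl⟩ := exists_orderOf_eq_of_generatesOrderDivisible hr hy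
  choose g hg using hy.1
  have hyz : y = symmetricToAut n ∘ fun i => (g i : Perm (Fin n)) * σ * (g i : Perm (Fin n))⁻¹ := by
    funext i
    simp only [hg, Function.comp_apply, map_mul, map_inv, symmetricToAut_coe]
  rw [hyz, Set.range_comp, ← MonoidHom.map_closure] at hw
  obtain ⟨t, ht, rfl⟩ := hw
  rw [orderOf_injective _ (symmetricToAut_injective hn)] at hr ⊢
  have hle := orderOf_le_of_mem_closure_isSwap (fun i => ?_) ht hr
  · exact_mod_cast Nat.sub_le_of_le_add hle
  · obtain ⟨a, b, hab, rfl⟩ := hσ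
    exact ⟨(g i).1 a, (g i).1 b, (g i).1.injective.ne hab, (swap_apply_apply _ _ _).symm⟩

end SwapLowerBound

section ThreeCycles

variable {α : Type*} [Fintype α] [DecidableEq α] {c d : Perm α}

theorem mem_of_isThreeCycle (hc : c.IsThreeCycle) {z w : α} (hz : c z ≠ z) (hw : c w ≠ w) :
    w ∈ [z, c z, c (c z)] := by
  rw [eq_formPerm_of_isThreeCycle hc hz] at hw
  exact List.mem_of_formPerm_apply_ne hw

theorem apply_apply_apply_of_pow_three {α : Type*} {c : Perm α} (hc : c ^ 3 = 1) (z : α) :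
    c (c (c z)) = z := by
  simpa [pow_three] using congr($hc z)

theorem pow_three_of_isThreeCycle (hc : c.IsThreeCycle) : c ^ 3 = 1 :=
  hc.orderOf ▸ pow_orderOf_eq_one c

theorem exists_common_arc (hc : c.IsThreeCycle) (hd : d.IsThreeCycle) (h : (c * d) ^ 2 = 1)
    (hne : c * d ≠ 1) : ∃ z, c z ≠ z ∧ d z = c z := by
  by_contra! hno
  have hcd : ∀ z, c (d (c (d z))) = z := fun z => by simpa [pow_two] using congr($h z)
  have hc3 := apply_apply_apply_of_pow_three (pow_three_of_isThreeCycle hc)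
  have hsub : c.support ⊆ d.support := by
    intro z hz
    rw [mem_support] at hz ⊢
    intro hdz
    refine hno (c z) (by simpa using hz) (c.injective ?_)
    rw [hc3]
    simpa only [hdz] using hcd z
  have hsupp : ∀ z, c z = z ↔ d z = z := fun z => by
    rw [← notMem_support, ← notMem_support, Finset.eq_of_subset_of_card_le hsub
      (hd.card_support.trans hc.card_support.symm).le]
  refine hne (Perm.ext fun z => ?_)
  rw [Perm.mul_apply, Perm.one_apply]
  by_cases hz : c z = z
  · rw [(hsupp z).1 hz, hz]
  · have hdz : d z ≠ z := (hsupp z).not.1 hz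
    have hmem := mem_of_isThreeCycle hc hz ((hsupp (d z)).not.2 (d.injective.ne hdz))
    have hdcc : d z = c (c z) := by simpa [hdz, hno z hz] using hmem
    rw [hdcc, hc3]

theorem apply_eq_of_common_arcs {e : Perm α} (hc : c.IsThreeCycle) (hd : d.IsThreeCycle)
    (he : e.IsThreeCycle) {a : α} (ha : c a ≠ a) (hda : d a = c a) (hcd : c ≠ d)
    (hec : ∃ z, c z ≠ z ∧ e z = c z) (hed : ∃ z, d z ≠ z ∧ e z = d z) : e a = c a := by
  obtain ⟨z, hz, hez⟩ := hec
  obtain ⟨w, hw, hew⟩ := hed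
  have hs : c (c a) ≠ d (c a) := fun h => hcd (by
    rw [eq_formPerm_of_isThreeCycle hc ha, eq_formPerm_of_isThreeCycle hd (hda ▸ ha), hda, h])
  have hc3 := apply_apply_apply_of_pow_three (pow_three_of_isThreeCycle hc) a
  have hd3 := apply_apply_apply_of_pow_three (pow_three_of_isThreeCycle hd) a
  have he3 := apply_apply_apply_of_pow_three (pow_three_of_isThreeCycle he) (c a)
  have hzmem := mem_of_isThreeCycle hc ha hz
  have hwmem := mem_of_isThreeCycle hd (hda ▸ ha) hw
  rw [hda] at hd3 hwmem
  have hemem : ∀ y, e (c a) ≠ c a → e y ≠ y → y ∈ [c a, e (c a), e (e (c a))] :=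
    fun y => mem_of_isThreeCycle he
  simp only [List.mem_cons, List.not_mem_nil, or_false] at hzmem hwmem hemem
  rcases hzmem with rfl | rfl | rfl
  · exact hez
  · rcases hwmem with rfl | rfl | rfl
    · exact hew.trans hda
    · exact absurd (hez.symm.trans hew) hs
    · grind
  · rcases hwmem with rfl | rfl | rfl
    · exact hew.trans hda
    · grind
    · exact absurd (e.injective (hez.trans (hc3.trans (hew.trans hd3).symm))) hs

theorem exists_forall_apply_eq_of_common_arcs {ι : Type*} {E : ι → Perm α} {J : Set ι}
    (hE : ∀ j ∈ J, (E j).IsThreeCycle) (hinj : J.InjOn E)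
    (harc : ∀ i ∈ J, ∀ j ∈ J, i ≠ j → ∃ z, E i z ≠ z ∧ E j z = E i z) (hJ : J.Nontrivial) :
    ∃ a b, a ≠ b ∧ ∀ j ∈ J, E j a = b := by
  obtain ⟨u, hu, v, hv, huv⟩ := hJ
  obtain ⟨a, ha, hva⟩ := harc u hu v hv huv
  refine ⟨a, E u a, ha.symm, fun j hj => ?_⟩
  rcases eq_or_ne u j with rfl | huj
  · rfl
  rcases eq_or_ne v j with rfl | hvj
  · exact hva
  exact apply_eq_of_common_arcs (hE u hu) (hE v hv) (hE j hj) ha hva (hinj.ne hu hv huv)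
    (harc u hu j hj huj) (harc v hv j hj hvj)

theorem mem_or_swap_mul_mem {α : Type*} [Finite α] [DecidableEq α] {p q : α}
    {H : Subgroup (Perm α)}
    (hH : ∀ j, j ≠ q → swap p q * swap q j ∈ H) (g : Perm α) : g ∈ H ∨ swap p q * g ∈ H := by
  have hstep : ∀ j, j ≠ q → ∀ g, g ∈ H ∨ swap p q * g ∈ H →
      swap q j * g ∈ H ∨ swap p q * (swap q j * g) ∈ H := by
    rintro j hj g (hg | hg)
    · right
      simpa only [mul_assoc] using mul_mem (hH j hj) hg
    · left
      have hmem := mul_mem (inv_mem (hH j hj)) hg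
      simpa only [mul_inv_rev, swap_inv, mul_assoc, swap_mul_self_mul] using hmem
  induction g using swap_induction_on with
  | one => exact .inl (one_mem H)
  | swap_mul g i j hij hg =>
    rcases eq_or_ne i q with rfl | hi
    · exact hstep j hij.symm g hg
    rcases eq_or_ne j q with rfl | hj
    · rw [swap_comm]
      exact hstep i hi g hg
    rw [← swap_mul_swap_mul_swap hj hij.symm, swap_comm j q, mul_assoc, mul_assoc]
    exact hstep i hi _ (hstep j hj _ (hstep i hi g hg))

theorem alternatingGroup_le_of_forall_formPerm_mem {p q : α} (hpq : p ≠ q) {H : Subgroup (Perm α)}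
    (hH : ∀ j ∉ [p, q], [p, q, j].formPerm ∈ H) : alternatingGroup α ≤ H := by
  intro g hg
  have hmem : ∀ j, j ≠ q → swap p q * swap q j ∈ H ⊓ alternatingGroup α := by
    refine fun j hj => ⟨?_, mem_alternatingGroup.2 (by simp [sign_swap hpq, sign_swap hj.symm])⟩
    rcases eq_or_ne j p with rfl | hjp
    · simp [swap_comm j]
    · simpa using hH j (by simp [hjp, hj])
  refine ((mem_or_swap_mul_mem hmem g).resolve_right fun h => ?_).1
  have hsign := mem_alternatingGroup.1 h.2
  rw [Perm.sign_mul, mem_alternatingGroup.1 hg, sign_swap hpq] at hsign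
  exact absurd hsign (by decide)

theorem mul_formPerm_mul_inv {α : Type*} [DecidableEq α] (σ : Perm α) (l : List α) :
    σ * l.formPerm * σ⁻¹ = (l.map σ).formPerm := by
  induction l using List.twoStepInduction with
  | nil | singleton => simp
  | cons_cons a b l _ ih =>
    simp only [List.map_cons, List.formPerm_cons_cons] at ih ⊢
    rw [← ih b, swap_apply_apply]
    group

theorem sq_formPerm_mul_formPerm {α : Type*} [DecidableEq α] {p q i j : α}
    (h : [p, q, i, j].Nodup) :
    ([p, q, i].formPerm * [p, q, j].formPerm) ^ 2 = 1 ∧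
      [p, q, i].formPerm * [p, q, j].formPerm ≠ 1 := by
  let e : Fin 4 ↪ α := listEmbedding h rfl
  have hi : viaEmbeddingHom e ([0, 1, 2] : List (Fin 4)).formPerm = [p, q, i].formPerm :=
    viaEmbeddingHom_formPerm e _
  have hj : viaEmbeddingHom e ([0, 1, 3] : List (Fin 4)).formPerm = [p, q, j].formPerm :=
    viaEmbeddingHom_formPerm e _
  rw [← hi, ← hj, ← map_mul, ← map_pow, Ne, map_eq_one_iff _ (viaEmbeddingHom_injective _),
    map_eq_one_iff _ (viaEmbeddingHom_injective _)]
  decide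

theorem exists_conj_formPerm_eq {p q a b : α} (hpq : p ≠ q) {E : α → Perm α}
    (hE : ∀ j ∉ [p, q], (E j).IsThreeCycle) (hinj : Set.InjOn E {j | j ∉ [p, q]})
    (hab : a ≠ b) (harc : ∀ j ∉ [p, q], E j a = b) :
    ∃ π : Perm α, ∀ j ∉ [p, q], π * [p, q, j].formPerm * π⁻¹ = E j := by
  have hform : ∀ j ∉ [p, q], E j = [a, b, E j b].formPerm := fun j hj => by
    have h := eq_formPerm_of_isThreeCycle (hE j hj) (a := a) (harc j hj ▸ hab.symm)
    rwa [harc j hj] at h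
  have hnodup : ∀ j ∉ [p, q], [a, b, E j b].Nodup := fun j hj => by
    have h := nodup_of_isThreeCycle (hE j hj) (a := a) (harc j hj ▸ hab.symm)
    rwa [harc j hj] at h
  let f : α → α := fun z => if z = p then a else if z = q then b else E z b
  have hf : Function.Injective f := by
    intro y z hyz
    have hEb : y ∉ [p, q] → z ∉ [p, q] → E y b = E z b → y = z := fun hy hz h =>
      hinj hy hz (by rw [hform y hy, hform z hz, h])
    grind
  refine ⟨Equiv.ofBijective f (Finite.injective_iff_bijective.1 hf), fun j hj => ?_⟩
  rw [hform j hj, mul_formPerm_mul_inv]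
  simp only [List.mem_cons, List.not_mem_nil, or_false, not_or] at hj
  simp [f, hj.1, hj.2, hpq.symm]

end ThreeCycles

section CommutatorOrder

variable {α : Type*} [Fintype α] [DecidableEq α] {σ : Perm α}

theorem orderOf_le_card_support (hp : (orderOf σ).Prime) : orderOf σ ≤ σ.support.card := by
  obtain ⟨a, ha⟩ := exists_apply_ne_of_ne_one fun h => hp.ne_one (orderOf_eq_one_iff.2 h)
  rw [← card_support_cycleOf_of_orderOf_prime hp ha]
  exact Finset.card_le_card (support_cycleOf_le σ a)

theorem card_support_commutatorElement_le (σ τ : Perm α) :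
    ⁅σ, τ⁆.support.card ≤ 2 * σ.support.card := by
  have h : ⁅σ, τ⁆ = σ * (τ * σ⁻¹ * τ⁻¹) := by group
  calc ⁅σ, τ⁆.support.card ≤ (σ.support ∪ (τ * σ⁻¹ * τ⁻¹).support).card :=
        h ▸ Finset.card_le_card (support_mul_le _ _)
    _ ≤ σ.support.card + (τ * σ⁻¹ * τ⁻¹).support.card := Finset.card_union_le _ _
    _ = 2 * σ.support.card := by rw [card_support_conj, support_inv, two_mul]

theorem exists_orderOf_commutatorElement_eq {k : ℕ} (e : Fin k ↪ α) {s g : Perm (Fin k)}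
    (hg : sign g = 1) (h : ∀ i, g i ≠ i → σ (e i) = e (s i)) :
    ∃ τ ∈ alternatingGroup α, orderOf ⁅σ, τ⁆ = orderOf ⁅s, g⁆ := by
  refine ⟨viaEmbeddingHom e g, mem_alternatingGroup.2 ((sign_viaEmbedding e g).trans hg), ?_⟩
  rw [commutatorElement_viaEmbeddingHom e h, orderOf_injective _ (viaEmbeddingHom_injective e)]

theorem exists_orderOf_commutatorElement_eq_seven (hσ : ∀ z, σ (σ (σ z)) = z) {a b c : α}
    (h : [c, a, σ a, σ (σ a), b, σ b, σ (σ b)].Nodup) :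
    ∃ τ ∈ alternatingGroup α, orderOf ⁅σ, τ⁆ = 7 := by
  have : Fact (Nat.Prime 7) := ⟨by norm_num⟩
  by_cases hc : σ c = c
  · obtain ⟨τ, hτ, h7⟩ := exists_orderOf_commutatorElement_eq (σ := σ)
      (listEmbedding h (k := 7) rfl) (s := c[1, 2, 3] * c[4, 5, 6]) (g := c[1, 2, 4, 0, 5])
      (by decide) (by intro i hi; fin_cases i <;> first | rfl | exact hc | exact absurd rfl hi)
    exact ⟨τ, hτ, h7.trans (orderOf_eq_prime (by decide +kernel) (by decide +kernel))⟩
  · have h9 : [c, σ c, σ (σ c), a, σ a, σ (σ a), b, σ b, σ (σ b)].Nodup := by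
      obtain ⟨hcl, hl⟩ := List.nodup_cons.1 h
      have hmem : ∀ z, σ z ∈ [a, σ a, σ (σ a), b, σ b, σ (σ b)] →
          z ∈ [a, σ a, σ (σ a), b, σ b, σ (σ b)] := by
        grind [σ.injective.eq_iff]
      generalize [a, σ a, σ (σ a), b, σ b, σ (σ b)] = l at hcl hl hmem ⊢
      have h1 := mt (hmem c) hcl
      have h2 := mt (hmem (σ c)) h1
      grind [σ.injective.eq_iff]
    obtain ⟨τ, hτ, h7⟩ := exists_orderOf_commutatorElement_eq (σ := σ)
      (listEmbedding h9 (k := 9) rfl) (s := c[0, 1, 2] * c[3, 4, 5] * c[6, 7, 8])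
      (g := c[3, 6, 4, 7, 0])
      (by decide) (by intro i hi; fin_cases i <;> first | rfl | exact absurd rfl hi)
    exact ⟨τ, hτ, h7.trans (orderOf_eq_prime (by decide +kernel) (by decide +kernel))⟩

end CommutatorOrder

section Automorphisms

variable {n : ℕ} {x : MulAut (alternatingGroup (Fin n))}

theorem isThreeCycle_apply_of_isThreeCycle_apply (hn : 5 ≤ n) {c d : alternatingGroup (Fin n)}
    (hc : (c : Perm (Fin n)).IsThreeCycle) (hd : (d : Perm (Fin n)).IsThreeCycle)
    (hxc : (x c : Perm (Fin n)).IsThreeCycle) : (x d : Perm (Fin n)).IsThreeCycle := by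
  obtain ⟨g, rfl⟩ := isConj_iff.1
    (alternatingGroup.isThreeCycle_isConj (by simpa using hn) hc hd)
  rw [IsThreeCycle] at hxc ⊢
  simpa [map_mul, map_inv, cycleType_conj] using hxc

theorem symmetricToAut_eq_of_forall_formPerm {p q : Fin n} (hpq : p ≠ q) {π : Perm (Fin n)}
    {C : Fin n → alternatingGroup (Fin n)}
    (hC : ∀ j ∉ [p, q], (C j : Perm (Fin n)) = [p, q, j].formPerm)
    (hπ : ∀ j ∉ [p, q], π * [p, q, j].formPerm * π⁻¹ = x (C j)) : symmetricToAut n π = x := by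
  have hle : alternatingGroup (Fin n) ≤
      ((symmetricToAut n π).toMonoidHom.eqLocus x.toMonoidHom).map
        (alternatingGroup (Fin n)).subtype := by
    refine alternatingGroup_le_of_forall_formPerm_mem hpq fun j hj => ?_
    refine ⟨C j, Subtype.ext ?_, hC j hj⟩
    exact (coe_symmetricToAut_apply π (C j)).trans (hC j hj ▸ hπ j hj)
  ext1 g
  obtain ⟨g', hg', e⟩ := hle g.2
  obtain rfl : g' = g := Subtype.ext e
  exact hg'

theorem exists_common_arc_apply {i j p q : Fin n} (h : [p, q, i, j].Nodup)
    {c d : alternatingGroup (Fin n)} (hc : (c : Perm (Fin n)) = [p, q, i].formPerm)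
    (hd : (d : Perm (Fin n)) = [p, q, j].formPerm) (hxc : (x c : Perm (Fin n)).IsThreeCycle)
    (hxd : (x d : Perm (Fin n)).IsThreeCycle) :
    ∃ z, (x c : Perm (Fin n)) z ≠ z ∧ (x d : Perm (Fin n)) z = (x c : Perm (Fin n)) z := by
  obtain ⟨hsq, hne⟩ := sq_formPerm_mul_formPerm h
  rw [← hc, ← hd] at hsq hne
  have hcd : (c * d) ^ 2 = 1 := Subtype.ext hsq
  refine exists_common_arc hxc hxd ?_ fun h1 => hne ?_
  · simpa using congr((x $hcd : Perm (Fin n)))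
  · have : c * d = 1 :=
      x.injective ((map_mul x c d).trans ((Subtype.ext h1).trans (map_one x).symm))
    exact congr(($this : Perm (Fin n)))

theorem exists_eq_formPerm {p q : Fin n} (hpq : p ≠ q) : ∃ C : Fin n → alternatingGroup (Fin n),
    ∀ j ∉ [p, q], (C j : Perm (Fin n)) = [p, q, j].formPerm := by
  have hC : ∀ j, ∃ c : alternatingGroup (Fin n),
      j ∉ [p, q] → (c : Perm (Fin n)) = [p, q, j].formPerm := fun j => by
    by_cases hj : j ∈ [p, q]
    · exact ⟨1, absurd hj⟩
    · exact ⟨⟨_, (isThreeCycle_formPerm (by grind : [p, q, j].Nodup)).mem_alternatingGroup⟩,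
        fun _ => rfl⟩
  exact Classical.axiomOfChoice hC

theorem mem_range_symmetricToAut_of_isThreeCycle (hn : 5 ≤ n) {c : alternatingGroup (Fin n)}
    (hc : (c : Perm (Fin n)).IsThreeCycle) (hxc : (x c : Perm (Fin n)).IsThreeCycle) :
    x ∈ (symmetricToAut n).range := by
  obtain ⟨p, q, u, v, hnd⟩ : ∃ p q u v : Fin n, [p, q, u, v].Nodup :=
    ⟨⟨0, by omega⟩, ⟨1, by omega⟩, ⟨2, by omega⟩, ⟨3, by omega⟩, by simp⟩
  have hpq : p ≠ q := by grind
  obtain ⟨C, hC⟩ := exists_eq_formPerm hpq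
  have hE : ∀ j ∉ [p, q], (x (C j) : Perm (Fin n)).IsThreeCycle := fun j hj =>
    isThreeCycle_apply_of_isThreeCycle_apply hn hc
      (hC j hj ▸ isThreeCycle_formPerm (by grind)) hxc
  have hinj : Set.InjOn (fun j => (x (C j) : Perm (Fin n))) {j | j ∉ [p, q]} := by
    intro i hi j hj h
    have hij := congr(($(x.injective (Subtype.ext h)) : Perm (Fin n)) q)
    rw [hC i hi, hC j hj] at hij
    simp only [Set.mem_ofPred_eq, List.mem_cons, List.not_mem_nil, or_false, not_or] at hi hj
    simpa [hi, hj, List.formPerm_cons_cons, swap_apply_of_ne_of_ne] using hij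
  obtain ⟨a, b, hab, harc⟩ := exists_forall_apply_eq_of_common_arcs hE hinj
    (fun i (hi : i ∉ [p, q]) j (hj : j ∉ [p, q]) hij =>
      exists_common_arc_apply (by grind) (hC i hi) (hC j hj) (hE i hi) (hE j hj))
    ⟨u, show u ∉ [p, q] by grind, v, show v ∉ [p, q] by grind, by grind⟩
  obtain ⟨π, hπ⟩ := exists_conj_formPerm_eq hpq hE hinj hab harc
  exact ⟨π, symmetricToAut_eq_of_forall_formPerm hpq hC hπ⟩

theorem apply_pow_three_of_isThreeCycle {c : alternatingGroup (Fin n)}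
    (hc : (c : Perm (Fin n)).IsThreeCycle) : x c ^ 3 = 1 := by
  have h3 : c ^ 3 = 1 := Subtype.ext (pow_three_of_isThreeCycle hc)
  rw [← map_pow, h3, map_one]

theorem apply_ne_one_of_isThreeCycle {c : alternatingGroup (Fin n)}
    (hc : (c : Perm (Fin n)).IsThreeCycle) : x c ≠ 1 := by
  rw [Ne, map_eq_one_iff x x.injective]
  rintro rfl
  exact hc.isCycle.ne_one rfl

theorem isThreeCycle_apply (h6 : n ≠ 6) {c : alternatingGroup (Fin n)}
    (hc : (c : Perm (Fin n)).IsThreeCycle) : (x c : Perm (Fin n)).IsThreeCycle := by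
  have h3 := apply_apply_apply_of_pow_three
    (congrArg Subtype.val (apply_pow_three_of_isThreeCycle (x := x) hc))
  refine (isThreeCycle_or_exists_nodup h3 fun h =>
    apply_ne_one_of_isThreeCycle hc (Subtype.ext h)).resolve_right ?_
  rintro ⟨a, b, hab⟩
  have hle := hab.length_le_card
  obtain ⟨d, hd⟩ := exists_notMem_of_length_lt [a, (x c).1 a, (x c).1 ((x c).1 a), b, (x c).1 b,
    (x c).1 ((x c).1 b)] (hle.lt_of_ne (by simpa using h6.symm))
  obtain ⟨τ, hτ, h7⟩ := exists_orderOf_commutatorElement_eq_seven h3 (List.nodup_cons.2 ⟨hd, hab⟩)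
  obtain ⟨k, hk⟩ := x.surjective ⟨τ, hτ⟩
  have hck : orderOf ⁅(c : Perm (Fin n)), (k : Perm (Fin n))⁆ = 7 := calc
    orderOf ⁅(c : Perm (Fin n)), (k : Perm (Fin n))⁆ = orderOf ⁅c, k⁆ := Subgroup.orderOf_coe ⁅c, k⁆
    _ = orderOf ⁅x c, x k⁆ := by rw [← map_commutatorElement, MulEquiv.orderOf_eq]
    _ = 7 := by rw [hk, ← h7]; exact (Subgroup.orderOf_coe _).symm
  have h6 := (orderOf_le_card_support (hck ▸ by norm_num)).trans
    (card_support_commutatorElement_le (c : Perm (Fin n)) k)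
  rw [hck, hc.card_support] at h6
  omega

theorem exists_isThreeCycle (hn : 3 ≤ n) :
    ∃ c : alternatingGroup (Fin n), (c : Perm (Fin n)).IsThreeCycle := by
  have hnd : [(⟨0, by omega⟩ : Fin n), ⟨1, by omega⟩, ⟨2, by omega⟩].Nodup := by simp
  exact ⟨⟨_, (isThreeCycle_formPerm hnd).mem_alternatingGroup⟩, isThreeCycle_formPerm hnd⟩

theorem mem_range_symmetricToAut (hn : 5 ≤ n) (h6 : n ≠ 6)
    (x : MulAut (alternatingGroup (Fin n))) : x ∈ (symmetricToAut n).range := by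
  obtain ⟨c, hc⟩ := exists_isThreeCycle (show 3 ≤ n by omega)
  exact mem_range_symmetricToAut_of_isThreeCycle hn hc (isThreeCycle_apply h6 hc)

end Automorphisms

section Involutions

variable {G : Type*} [Group G] {a b w : G}

theorem mem_zpowers_or_mul_mem_zpowers (ha : a * a = 1) (hb : b * b = 1)
    (hw : w ∈ Subgroup.closure {a, b}) :
    w ∈ Subgroup.zpowers (a * b) ∨ w * a ∈ Subgroup.zpowers (a * b) := by
  have hab := Subgroup.mem_zpowers (a * b)
  have ha' : a⁻¹ = a := inv_eq_of_mul_eq_one_left ha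
  have hb' : b⁻¹ = b := inv_eq_of_mul_eq_one_left hb
  have hstep : ∀ v, ∀ s ∈ ({a, b} : Set G),
      v ∈ Subgroup.zpowers (a * b) ∨ v * a ∈ Subgroup.zpowers (a * b) →
      v * s ∈ Subgroup.zpowers (a * b) ∨ v * s * a ∈ Subgroup.zpowers (a * b) := by
    rintro v s (rfl | rfl) (hv | hv)
    · exact .inr (by rwa [mul_assoc, ha, mul_one])
    · exact .inl hv
    · exact .inr (by simpa [mul_assoc, ha', hb'] using mul_mem hv (inv_mem hab))
    · exact .inl (by simpa [mul_assoc, ← mul_assoc a a, ha] using mul_mem hv hab)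
  induction hw using Subgroup.closure_induction_right with
  | one => exact .inl (one_mem _)
  | mul_right v _ s hs hv => exact hstep v s hs hv
  | mul_inv_cancel v _ s hs hv =>
    have hs' : s⁻¹ = s := by rcases hs with rfl | rfl <;> assumption
    exact hs'.symm ▸ hstep v s hs hv

theorem conj_eq_inv_of_mem_zpowers_mul (ha : a * a = 1) (hb : b * b = 1)
    (hw : w ∈ Subgroup.zpowers (a * b)) : a * w * a⁻¹ = w⁻¹ := by
  obtain ⟨k, rfl⟩ := hw
  have hab : a * (a * b) * a⁻¹ = (a * b)⁻¹ := by
    rw [← mul_assoc, ha, one_mul, mul_inv_rev, inv_eq_of_mul_eq_one_left hb]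
  rw [← conj_zpow, hab, inv_zpow]

theorem mem_zpowers_mul_of_odd_orderOf (ha : a * a = 1) (hb : b * b = 1)
    (hw : w ∈ Subgroup.closure {a, b}) (hodd : Odd (orderOf w)) :
    w ∈ Subgroup.zpowers (a * b) := by
  rcases mem_zpowers_or_mul_mem_zpowers ha hb hw with h | h
  · exact h
  · have hflip := conj_eq_inv_of_mem_zpowers_mul ha hb h
    rw [← mul_assoc, mul_inv_cancel_right, mul_inv_rev, inv_eq_of_mul_eq_one_left ha,
      mul_left_cancel_iff, eq_inv_iff_mul_eq_one, ← sq] at hflip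
    have h1 : orderOf w = 1 := (Nat.dvd_prime Nat.prime_two).1 (orderOf_dvd_of_pow_eq_one hflip)
      |>.resolve_right fun h2 => absurd (h2 ▸ hodd) (by decide)
    exact orderOf_eq_one_iff.1 h1 ▸ one_mem _

theorem MemConjClosure.exists_mem_conj_eq_inv {N : Subgroup G} [N.Normal] {x t : G}
    (hx : x * x = 1) (h : MemConjClosure N x 2 t) (hodd : Odd (orderOf t)) :
    ∃ s ∈ N, orderOf s = orderOf t ∧ x * s * x⁻¹ = s⁻¹ := by
  obtain ⟨y, hy, ht⟩ := h
  obtain ⟨g, hg, hyg⟩ := hy 0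
  obtain ⟨k, hk, hyk⟩ := hy 1
  have hinv : ∀ i, y i * y i = 1 := fun i => by
    obtain ⟨l, -, e⟩ := hy i
    rw [e, conj_mul, hx, mul_one, mul_inv_cancel]
  have hle : Set.range y ⊆ {y 0, y 1} := by
    rintro _ ⟨i, rfl⟩
    fin_cases i <;> simp
  have hz := mem_zpowers_mul_of_odd_orderOf (hinv 0) (hinv 1) (Subgroup.closure_mono hle ht) hodd
  have hflip := conj_eq_inv_of_mem_zpowers_mul (hinv 0) (hinv 1) hz
  have hprod : y 0 * y 1 = g * (x * (g⁻¹ * k) * x⁻¹) * k⁻¹ := by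
    rw [hyg, hyk, inv_eq_of_mul_eq_one_left hx]; group
  have hN : y 0 * y 1 ∈ N := hprod ▸ mul_mem
    (mul_mem hg (Subgroup.Normal.conj_mem ‹_› _ (mul_mem (inv_mem hg) hk) x)) (inv_mem hk)
  refine ⟨g⁻¹ * t * g, mul_mem (mul_mem (inv_mem hg) (Subgroup.zpowers_le.2 hN hz)) hg, ?_, ?_⟩
  · simpa using MulEquiv.orderOf_eq (MulAut.conj g⁻¹) t
  · rw [hyg] at hflip
    simpa [mul_assoc, eq_mul_inv_iff_mul_eq, inv_mul_eq_iff_eq_mul] using congr(g⁻¹ * $hflip * g)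

end Involutions

section SixLetters

theorem mul_conj_mul_inv_eq_conj_apply {L : Type*} [Group L] (x : MulAut L) (g : L) :
    x * MulAut.conj g * x⁻¹ = MulAut.conj (x g) := by
  ext v
  simp

theorem commutatorElement_eq_conj {L : Type*} [Group L] (x : MulAut L) (g : L) :
    ⁅x, MulAut.conj g⁆ = MulAut.conj (x g * g⁻¹) := by
  rw [commutatorElement_def, mul_conj_mul_inv_eq_conj_apply, map_mul, map_inv]

instance normal_range_conj {L : Type*} [Group L] : (MulAut.conj (G := L)).range.Normal :=
  ⟨by rintro _ ⟨g, rfl⟩ x; exact ⟨x g, (mul_conj_mul_inv_eq_conj_apply x g).symm⟩⟩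

theorem conj_alternatingGroup_injective {n : ℕ} (hn : 4 ≤ n) :
    Function.Injective (MulAut.conj (G := alternatingGroup (Fin n))) := fun g h e =>
  Subtype.ext (symmetricToAut_injective hn
    ((symmetricToAut_coe g).trans (e.trans (symmetricToAut_coe h).symm)))

theorem isConj_of_odd_commute {α : Type*} [Fintype α] [DecidableEq α] {σ τ : alternatingGroup α}
    (h : IsConj (σ : Perm α) τ) {ρ : Perm α} (hρ : sign ρ = -1) (hσ : Commute ρ σ) :
    IsConj σ τ := by
  obtain ⟨π, hπ⟩ := isConj_iff.1 h
  rcases Int.units_eq_one_or (sign π) with hs | hs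
  · exact isConj_iff.2 ⟨⟨π, hs⟩, Subtype.ext hπ⟩
  · refine isConj_iff.2 ⟨⟨π * ρ, mem_alternatingGroup.2 (by rw [Perm.sign_mul, hs, hρ]; rfl)⟩,
      Subtype.ext ?_⟩
    calc π * ρ * σ * (π * ρ)⁻¹ = π * (ρ * σ * ρ⁻¹) * π⁻¹ := by group
      _ = τ := by rw [hσ.eq, mul_inv_cancel_right, hπ]

/-- The representative `(0 1 2)(3 4 5)` of the conjugacy class of the alternating group on six
letters which an automorphism not induced by the symmetric group exchanges with the class of
3-cycles. -/
def doubleThreeCycle : alternatingGroup (Fin 6) :=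
  ⟨c[0, 1, 2] * c[3, 4, 5], mem_alternatingGroup.2 (by decide)⟩

theorem isConj_doubleThreeCycle {v : alternatingGroup (Fin 6)} (hv : orderOf v = 3)
    (hv' : ¬ (v : Perm (Fin 6)).IsThreeCycle) : IsConj doubleThreeCycle v := by
  refine isConj_of_odd_commute (ρ := swap 0 3 * swap 1 4 * swap 2 5) ?_ (by decide)
    (by unfold Commute SemiconjBy; decide +kernel)
  have hv3 : orderOf (v : Perm (Fin 6)) = 3 := (Subgroup.orderOf_coe v).trans hv
  obtain ⟨k, hk⟩ := cycleType_prime_order (hv3 ▸ Nat.prime_three)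
  rw [hv3] at hk
  have hsum := sum_cycleType_le (v : Perm (Fin 6))
  simp [hk] at hsum
  obtain rfl | rfl : k = 0 ∨ k = 1 := by omega
  · exact absurd hk hv'
  · rw [isConj_iff_cycleType_eq, hk]
    decide

variable {x : MulAut (alternatingGroup (Fin 6))} {c u v : alternatingGroup (Fin 6)}

theorem orderOf_eq_three_of_isThreeCycle (hc : (c : Perm (Fin 6)).IsThreeCycle) :
    orderOf c = 3 := by
  rw [← Subgroup.orderOf_coe, hc.orderOf]

theorem isThreeCycle_of_isConj (h : IsConj c v) (hc : (c : Perm (Fin 6)).IsThreeCycle) :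
    (v : Perm (Fin 6)).IsThreeCycle := by
  obtain ⟨g, rfl⟩ := isConj_iff.1 h
  rw [IsThreeCycle] at hc ⊢
  simpa [cycleType_conj] using hc

theorem isThreeCycle_apply_iff (hx : x ∉ (symmetricToAut 6).range) (hv : orderOf v = 3) :
    (x v : Perm (Fin 6)).IsThreeCycle ↔ ¬ (v : Perm (Fin 6)).IsThreeCycle := by
  refine ⟨fun hxv hv => hx (mem_range_symmetricToAut_of_isThreeCycle (by omega) hv hxv),
    fun hv' => ?_⟩
  obtain ⟨c, hc⟩ := exists_isThreeCycle (n := 6) (by omega)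
  have hw : ¬ (x⁻¹ c : Perm (Fin 6)).IsThreeCycle := fun h =>
    hx (inv_mem_iff.1 (mem_range_symmetricToAut_of_isThreeCycle (by omega) hc h))
  have hconj : IsConj (x⁻¹ c) v := (isConj_doubleThreeCycle
    ((MulEquiv.orderOf_eq _ c).trans (orderOf_eq_three_of_isThreeCycle hc)) hw).symm.trans
    (isConj_doubleThreeCycle hv hv')
  refine isThreeCycle_of_isConj (MonoidHom.map_isConj x.toMonoidHom hconj) ?_
  simpa using hc

theorem sq_mem_range_symmetricToAut (hx : x ∉ (symmetricToAut 6).range) :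
    x ^ 2 ∈ (symmetricToAut 6).range := by
  obtain ⟨c, hc⟩ := exists_isThreeCycle (n := 6) (by omega)
  have ho := orderOf_eq_three_of_isThreeCycle hc
  refine mem_range_symmetricToAut_of_isThreeCycle (by omega) hc ?_
  rw [sq, MulAut.mul_apply, isThreeCycle_apply_iff hx ((MulEquiv.orderOf_eq x c).trans ho),
    isThreeCycle_apply_iff hx ho]
  exact not_not.2 hc

theorem apply_ne_inv_of_notMem_range (hx : x ∉ (symmetricToAut 6).range) (hv : orderOf v = 3) :
    x v ≠ v⁻¹ := by
  intro h
  have hiff := isThreeCycle_apply_iff hx hv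
  rw [h, IsThreeCycle, Subgroup.coe_inv, cycleType_inv] at hiff
  exact iff_not_self hiff

theorem three_le_betaNumber_three (hx : x ∉ (symmetricToAut 6).range) (h2 : x * x = 1) :
    3 ≤ betaNumber 3 x := by
  refine le_iInf₂ fun m ⟨y, hy⟩ => ?_
  by_contra! hm
  have hm2 : m ≤ 2 := Nat.le_of_lt_succ (by exact_mod_cast hm)
  obtain ⟨t, ht, ht3⟩ := exists_orderOf_eq_of_generatesOrderDivisible Nat.prime_three hy
  have hmem : MemConjClosure (MulAut.conj (G := alternatingGroup (Fin 6))).range x m t :=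
    ⟨y, fun i => (hy.1 i).elim fun g hg => ⟨_, ⟨g, rfl⟩, hg⟩, ht⟩
  obtain ⟨_, ⟨v, rfl⟩, hv, hflip⟩ := (hmem.mono hm2).exists_mem_conj_eq_inv h2 (ht3 ▸ by decide)
  rw [ht3, orderOf_injective _ (conj_alternatingGroup_injective (by omega))] at hv
  rw [mul_conj_mul_inv_eq_conj_apply, ← map_inv] at hflip
  exact apply_ne_inv_of_notMem_range hx hv (conj_alternatingGroup_injective (by omega) hflip)

-- The word of order three in `hcheck` was found by a search over short words.
theorem commute_or_orderOf_doubleThreeCycle (hc : (c : Perm (Fin 6)).IsThreeCycle) :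
    Commute doubleThreeCycle c ∨ orderOf ⁅doubleThreeCycle, c⁆ = 5 ∧
      ∃ w ∈ Subgroup.closure {doubleThreeCycle⁻¹ * c, doubleThreeCycle * c⁻¹}, orderOf w = 3 := by
  have hcheck : ∀ i j k : Fin 6, [i, j, k].Nodup →
      let u : Perm (Fin 6) := c[0, 1, 2] * c[3, 4, 5]
      let d := [i, j, k].formPerm
      u * d = d * u ∨ (⁅u, d⁆ ^ 5 = 1 ∧ ⁅u, d⁆ ≠ 1) ∧
        ((u⁻¹ * d) ^ 2 * ((u * d⁻¹) * (u⁻¹ * d) * (u * d⁻¹)⁻¹)) ^ 3 = 1 ∧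
        (u⁻¹ * d) ^ 2 * ((u * d⁻¹) * (u⁻¹ * d) * (u * d⁻¹)⁻¹) ≠ 1 := by
    decide +kernel
  obtain ⟨a, ha⟩ := exists_apply_ne_of_ne_one hc.isCycle.ne_one
  have hcheck := hcheck _ _ _ (nodup_of_isThreeCycle hc ha)
  rw [← eq_formPerm_of_isThreeCycle hc ha] at hcheck
  have : Fact (Nat.Prime 5) := ⟨Nat.prime_five⟩
  refine hcheck.imp (fun h => Subtype.ext h) fun ⟨⟨h5, h5'⟩, h3, h3'⟩ =>
    ⟨?_, (doubleThreeCycle⁻¹ * c) ^ 2 *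
      ((doubleThreeCycle * c⁻¹) * (doubleThreeCycle⁻¹ * c) * (doubleThreeCycle * c⁻¹)⁻¹), ?_, ?_⟩
  · exact (Subgroup.orderOf_coe _).symm.trans (orderOf_eq_prime h5 h5')
  · have ha := Subgroup.subset_closure
      (Set.mem_insert (doubleThreeCycle⁻¹ * c) {doubleThreeCycle * c⁻¹})
    have hb := Subgroup.subset_closure
      (Set.mem_insert_of_mem (doubleThreeCycle⁻¹ * c) (Set.mem_singleton (doubleThreeCycle * c⁻¹)))
    exact mul_mem (pow_mem ha 2) (mul_mem (mul_mem hb ha) (inv_mem hb))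
  · exact (Subgroup.orderOf_coe _).symm.trans (orderOf_eq_prime h3 h3')

theorem commute_or_orderOf_of_isConj (hu : IsConj doubleThreeCycle u)
    (hc : (c : Perm (Fin 6)).IsThreeCycle) :
    Commute u c ∨ orderOf ⁅u, c⁆ = 5 ∧
      ∃ w ∈ Subgroup.closure {u⁻¹ * c, u * c⁻¹}, orderOf w = 3 := by
  obtain ⟨g, rfl⟩ := isConj_iff.1 hu
  obtain ⟨d, rfl⟩ := (MulAut.conj g).surjective c
  have hd : (d : Perm (Fin 6)).IsThreeCycle :=
    isThreeCycle_of_isConj (isConj_iff.2 ⟨g⁻¹, by simp [mul_assoc]⟩) hc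
  rw [← MulAut.conj_apply]
  refine (commute_or_orderOf_doubleThreeCycle hd).imp (fun h => h.map (MulAut.conj g)) ?_
  rintro ⟨h5, w, hw, h3⟩
  refine ⟨?_, MulAut.conj g w, ?_, (MulEquiv.orderOf_eq _ w).trans h3⟩
  · rw [← map_commutatorElement, MulEquiv.orderOf_eq, h5]
  · have := Subgroup.mem_map_of_mem (MulAut.conj g).toMonoidHom hw
    rw [MonoidHom.map_closure, Set.image_pair] at this
    simpa only [MulEquiv.coe_toMonoidHom, map_mul, map_inv] using this

theorem not_commute_apply_of_notMem_range (hx : x ∉ (symmetricToAut 6).range) (h2 : x * x = 1)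
    (hc : (c : Perm (Fin 6)).IsThreeCycle) : ¬ Commute (x c) c := by
  intro hcomm
  have hne : x c * c⁻¹ ≠ 1 := fun h => by
    have := (isThreeCycle_apply_iff hx (orderOf_eq_three_of_isThreeCycle hc)).1
    rw [mul_inv_eq_one.1 h] at this
    exact this hc hc
  have hpow : (x c * c⁻¹) ^ 3 = 1 := by
    rw [hcomm.inv_right.mul_pow, apply_pow_three_of_isThreeCycle hc, inv_pow, one_mul, inv_eq_one]
    simpa using apply_pow_three_of_isThreeCycle (x := 1) hc
  refine apply_ne_inv_of_notMem_range hx (orderOf_eq_prime hpow hne) ?_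
  rw [map_mul, map_inv, ← MulAut.mul_apply, h2, MulAut.one_apply, mul_inv_rev, inv_inv]

theorem exists_orderOf_eq_five_and_exists_orderOf_eq_three (hx : x ∉ (symmetricToAut 6).range)
    (h2 : x * x = 1) :
    ∃ c : alternatingGroup (Fin 6), orderOf ⁅x c, c⁆ = 5 ∧
      ∃ w ∈ Subgroup.closure {(x c)⁻¹ * c, x c * c⁻¹}, orderOf w = 3 := by
  obtain ⟨c, hc⟩ := exists_isThreeCycle (n := 6) (by omega)
  have ho := orderOf_eq_three_of_isThreeCycle hc
  have hu : IsConj doubleThreeCycle (x c) := isConj_doubleThreeCycle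
    ((MulEquiv.orderOf_eq x c).trans ho) fun h => (isThreeCycle_apply_iff hx ho).1 h hc
  exact ⟨c, (commute_or_orderOf_of_isConj hu hc).resolve_left
    (not_commute_apply_of_notMem_range hx h2 hc)⟩

theorem betaNumber_five_le_two (hx : x ∉ (symmetricToAut 6).range) (h2 : x * x = 1) :
    betaNumber 5 x ≤ 2 := by
  obtain ⟨c, hc, -⟩ := exists_orderOf_eq_five_and_exists_orderOf_eq_three hx h2
  have hxx : x (x c) = c := DFunLike.congr_fun h2 c
  have hcomm : ⁅x, MulAut.conj (c * x c)⁆ = MulAut.conj ⁅x c, c⁆ := by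
    rw [commutatorElement_eq_conj, map_mul x, hxx, mul_inv_rev, ← mul_assoc, commutatorElement_def]
  have hmem := (MemConjClosure.self MulAut.conj.range x).commutator ⟨c * x c, rfl⟩
  rw [hcomm] at hmem
  have := betaNumber_le_of_memConjClosure hmem
  rwa [orderOf_injective _ (conj_alternatingGroup_injective (by omega)), hc] at this

theorem betaNumber_three_le_three (hx : x ∉ (symmetricToAut 6).range) (h2 : x * x = 1) :
    betaNumber 3 x ≤ 3 := by
  obtain ⟨c, -, w, hw, hw3⟩ := exists_orderOf_eq_five_and_exists_orderOf_eq_three hx h2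
  let g : Fin 3 → alternatingGroup (Fin 6) := ![1, c, c⁻¹]
  let y : Fin 3 → MulAut (alternatingGroup (Fin 6)) := fun i =>
    MulAut.conj (g i) * x * (MulAut.conj (g i))⁻¹
  have hy : ∀ i, y i ∈ Subgroup.closure (Set.range y) := fun i => Subgroup.subset_closure ⟨i, rfl⟩
  have hg : ∀ i, MulAut.conj (x (g i) * (g i)⁻¹) ∈ Subgroup.closure (Set.range y) := fun i => by
    have hyi : y 0 * (y i)⁻¹ = ⁅x, MulAut.conj (g i)⁆ := by
      simp [y, g, commutatorElement_def, mul_assoc]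
    rw [← commutatorElement_eq_conj, ← hyi]
    exact mul_mem (hy 0) (inv_mem (hy i))
  have hle : Subgroup.closure {(x c)⁻¹ * c, x c * c⁻¹} ≤
      (Subgroup.closure (Set.range y)).comap MulAut.conj := by
    rw [Subgroup.closure_le]
    rintro _ (rfl | rfl)
    · simpa [g] using hg 2
    · exact hg 1
  have := betaNumber_le_of_memConjClosure ⟨y, fun i => ⟨_, ⟨g i, rfl⟩, rfl⟩, hle hw⟩
  rwa [orderOf_injective _ (conj_alternatingGroup_injective (by omega)), hw3] at this

end SixLetters

theorem betaNumber_le_sub_one {n r : ℕ} (hn : 5 ≤ n) (hodd : Odd r) (hr : r ≤ n)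
    {x : MulAut (alternatingGroup (Fin n))} (hx : x ≠ 1)
    (h : ¬ (r = 3 ∧ n = 6 ∧ IsInvolutionOutsideSymmetric x)) :
    betaNumber r x ≤ (r - 1 : ℕ) := by
  by_cases hsym : x ∈ (symmetricToAut n).range
  · obtain ⟨σ, rfl⟩ := hsym
    exact betaNumber_symmetricToAut_le_sub_one hn hodd hr fun h1 => hx (by rw [h1, map_one])
  obtain rfl : n = 6 := by_contra fun h6 => hsym (mem_range_symmetricToAut hn h6 x)
  by_cases h2 : x * x = 1
  · have hout : IsInvolutionOutsideSymmetric x :=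
      ⟨orderOf_eq_prime ((sq x).trans h2) hx, hsym⟩
    obtain rfl | rfl | rfl : r = 1 ∨ r = 3 ∨ r = 5 := by
      obtain ⟨k, rfl⟩ := hodd
      omega
    · simpa using betaNumber_le_of_memConjClosure (MemConjClosure.one MulAut.conj.range x 0)
    · exact absurd ⟨rfl, rfl, hout⟩ h
    · exact (betaNumber_five_le_two hsym h2).trans (by norm_num)
  · obtain ⟨σ, hσ⟩ := sq_mem_range_symmetricToAut hsym
    refine (betaNumber_le_betaNumber_pow r x 2).trans (hσ ▸ ?_)
    refine betaNumber_symmetricToAut_le_sub_one hn hodd hr fun h1 => h2 ?_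
    rw [← sq, ← hσ, h1, map_one]

theorem proposition2_general (n : ℕ) (hn : 5 ≤ n) (r : ℕ) (hodd : Odd r) (hrn : r ≤ n)
    (x : MulAut (alternatingGroup (Fin n))) (hx : x ≠ 1) :
    (r.Prime → IsTranspositionAut x → betaNumber r x = ((r - 1 : ℕ) : ℕ∞)) ∧
    (r = 3 ∧ n = 6 ∧ IsInvolutionOutsideSymmetric x → betaNumber r x = 3) ∧
    (¬ (r = 3 ∧ n = 6 ∧ IsInvolutionOutsideSymmetric x) →
      betaNumber r x ≤ ((r - 1 : ℕ) : ℕ∞)) := by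
  refine ⟨?_, ?_, betaNumber_le_sub_one hn hodd hrn hx⟩
  · rintro hr ⟨σ, hσ, rfl⟩
    refine le_antisymm ?_ (sub_one_le_betaNumber_of_isSwap (by omega) hr hσ)
    exact betaNumber_symmetricToAut_le_sub_one hn hodd hrn fun h1 => hx (by rw [h1, map_one])
  · rintro ⟨rfl, rfl, h2, hout⟩
    have hxx : x * x = 1 := by rw [← sq, ← h2, pow_orderOf_eq_one]
    exact le_antisymm (betaNumber_three_le_three hout hxx) (three_le_betaNumber_three hout hxx)

theorem proposition2 (n : ℕ) (hn : 5 ≤ n) (r : ℕ) (hr : r.Prime) (hodd : Odd r) (hrn : r ≤ n)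
    (x : MulAut (alternatingGroup (Fin n))) (hx : (orderOf x).Prime) :
    (IsTranspositionAut x → betaNumber r x = ((r - 1 : ℕ) : ℕ∞)) ∧
    (r = 3 ∧ n = 6 ∧ IsInvolutionOutsideSymmetric x → betaNumber r x = 3) ∧
    (¬ IsTranspositionAut x → ¬ (r = 3 ∧ n = 6 ∧ IsInvolutionOutsideSymmetric x) →
      betaNumber r x ≤ ((r - 1 : ℕ) : ℕ∞)) := by
  have h := proposition2_general n hn r hodd hrn x (by rintro rfl; simp [Nat.not_prime_one] at hx)
  exact ⟨h.1 hr, h.2.1, fun _ => h.2.2⟩
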